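/- Let $A=[\mathbf a_1,\mathbf a_2,\mathbf a_3]$ and $A'=[\mathbf a_1',\mathbf a_2',\mathbf a_3']$ be real $4\times 3$ matrices with columns $\mathbf a_i,\mathbf a_i'\in\mathbb R^4$, and suppose that $\mathbf a_3$ and $\mathbf a_3'$ are linearly independent. For $\mathbf v\in\mathbb R^4\setminus\{0\}$ let $\left[A\;\tfrac{\mathbf v}{\|\mathbf v\|}\right]$ be the $4\times4$ matrix obtained by appending the column $\mathbf v/\|\mathbf v\|$ to $A$, and let $\mathrm{proj}_{\mathbf v^\perp}$ denote the orthogonal projection of $\mathbb R^4$ onto the orthogonal complement of $\mathbf v$. Then the integral $$I_{\langle \mathrm{Lk}^2\rangle}(A,A')=\frac{1}{(2\pi)^2}\int_{\mathbb R^4}\frac{\det\left[A\;\tfrac{\mathbf v}{\|\mathbf v\|}\right]\det\left[A'\;\tfrac{\mathbf v}{\|\mathbf v\|}\right]}{\|\mathrm{proj}_{\mathbf v^\perp}(\mathbf a_3)\|^3\,\|\mathrm{proj}_{\mathbf v^\perp}(\mathbf a_3')\|^3}\,e^{-\|\mathbf v\|^2/2}\,d\mathbf v$$ converges absolutely, and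 $$\frac{\pi}{2}\,I_{\langle \mathrm{Lk}^2\rangle}(A,A')=\frac{\left(\|\mathbf a_3\|^2\|\mathbf a_3'\|^2-(\mathbf a_3\cdot\mathbf a_3')^2\right)\det(A^TA')+(\mathbf a_3\cdot\mathbf a_3')\,\det[\mathbf a_3,\mathbf a_1',\mathbf a_2',\mathbf a_3']\,\det[\mathbf a_3',\mathbf a_1,\mathbf a_2,\mathbf a_3]}{\|\mathbf a_3\|^2\|\mathbf a_3'\|^2\left(\|\mathbf a_3\|^2\|\mathbf a_3'\|^2-(\mathbf a_3\cdot\mathbf a_3')^2\right)^{3/2}} .$$ -/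

import Mathlib

open scoped Matrix

noncomputable section

/-- The `j`-th column of a `4 × 3` matrix, as a vector of Euclidean space `ℝ⁴`
(so columns `0`, `1`, `2` are `a₁`, `a₂`, `a₃`). -/
def colVec (A : Matrix (Fin 4) (Fin 3) ℝ) (j : Fin 3) : EuclideanSpace ℝ (Fin 4) :=
  WithLp.toLp 2 (A.col j)

/-- The square matrix `[A  x]`: the column `x` is appended on the right of `A`. -/
def appendCol (A : Matrix (Fin 4) (Fin 3) ℝ) (x : EuclideanSpace ℝ (Fin 4)) :
    Matrix (Fin 4) (Fin 4) ℝ :=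
  Matrix.of fun i => Fin.snoc (α := fun _ => ℝ) (A i) (x i)

/-- The square matrix `[x  A]`: the column `x` is put on the left of `A`. -/
def prependCol (x : EuclideanSpace ℝ (Fin 4)) (A : Matrix (Fin 4) (Fin 3) ℝ) :
    Matrix (Fin 4) (Fin 4) ℝ :=
  Matrix.of fun i => Fin.cons (α := fun _ => ℝ) (x i) (A i)

/-- The norm of the orthogonal projection of `x` to the orthogonal complement of the line
spanned by `v`. -/
def normProjPerp (v x : EuclideanSpace ℝ (Fin 4)) : ℝ :=
  ‖(Submodule.span ℝ {v})ᗮ.starProjection x‖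

/-- The integrand (with the Gaussian weight) of the integral over `ℝ⁴`. -/
def linkIntegrand (A A' : Matrix (Fin 4) (Fin 3) ℝ) (v : EuclideanSpace ℝ (Fin 4)) : ℝ :=
  (appendCol A (‖v‖⁻¹ • v)).det * (appendCol A' (‖v‖⁻¹ • v)).det /
      (normProjPerp v (colVec A 2) ^ 3 * normProjPerp v (colVec A' 2) ^ 3) *
    Real.exp (-‖v‖ ^ 2 / 2)

/-- The function `I_{⟨Lk²⟩}(A, A')`. -/
def ILinkSq (A A' : Matrix (Fin 4) (Fin 3) ℝ) : ℝ :=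
  1 / (2 * Real.pi) ^ 2 * ∫ v : EuclideanSpace ℝ (Fin 4), linkIntegrand A A' v

end

/-!
The determinants in the integrand are inner products of `v` with the cross products `n`, `n'` of the
columns of the two matrices, and the denominators are areas of parallelograms spanned by `v` and the
last columns `c`, `d`. Rescale `c` and `d` to vectors `p`, `q` whose norms equal the area of their
parallelogram, and parametrize space by the slopes `x` of `v` in the plane of `p` and `q` and by a
vector `y` orthogonal to that plane, setting
`v = (‖y‖ (x₀ p + x₁ q) + y) / √(1 + ‖x₀ p + x₁ q‖²)`.
Then `‖v‖ = ‖y‖`, the two areas become proportional to `√(1 + x₁²)` and `√(1 + x₀²)`, and in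
dimension `4` all powers of `√(1 + ‖x₀ p + x₁ q‖²)` cancel against the Jacobian. Since `n ⟂ p` and
`n' ⟂ q`, the integrand is a product of one factor for each slope and a Gaussian in `y`. The parts
linear in the slopes integrate to zero, and what remains is a second moment of the Gaussian on the
orthogonal plane, which is the inner product of the projections of `n` and `n'`.
-/

open MeasureTheory Module Real
open scoped RealInnerProductSpace

section CrossProduct

variable (A A' : Matrix (Fin 4) (Fin 3) ℝ) (x : EuclideanSpace ℝ (Fin 4))

/-- The generalized cross product of the three columns of `A`, that is, the vector representing the
linear form `x ↦ det [A x]`. Its coordinates are the cofactors of the last column, whatever that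
column is; hence the choice of the zero column. -/
noncomputable def crossVec : EuclideanSpace ℝ (Fin 4) :=
  WithLp.toLp 2 ((appendCol A 0).adjugate (Fin.last 3))

theorem appendCol_castSucc (i : Fin 4) (j : Fin 3) : appendCol A x i j.castSucc = A i j :=
  Fin.snoc_castSucc (α := fun _ => ℝ) ..

theorem appendCol_last (i : Fin 4) : appendCol A x i (Fin.last 3) = x i :=
  Fin.snoc_last (α := fun _ => ℝ) (x i) (A i)

theorem appendCol_eq_updateCol :
    appendCol A x = (appendCol A 0).updateCol (Fin.last 3) x.ofLp := by
  ext i j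
  induction j using Fin.lastCases with
  | last => rw [appendCol_last, Matrix.updateCol_self]
  | cast j =>
    rw [appendCol_castSucc, Matrix.updateCol_ne (Fin.castSucc_lt_last j).ne, appendCol_castSucc]

theorem det_appendCol : (appendCol A x).det = ⟪crossVec A, x⟫ := by
  rw [appendCol_eq_updateCol, ← Matrix.cramer_apply, Matrix.cramer_eq_adjugate_mulVec,
    Matrix.mulVec, dotProduct_comm]
  rfl

theorem prependCol_eq_submatrix :
    prependCol x A = (appendCol A x).submatrix id (finRotate 4).symm := by
  ext i j
  fin_cases j <;> rfl

theorem det_prependCol : (prependCol x A).det = -⟪crossVec A, x⟫ := by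
  rw [prependCol_eq_submatrix, Matrix.det_permute', Equiv.Perm.sign_symm, sign_finRotate,
    det_appendCol]
  norm_num

theorem inner_crossVec_colVec (j : Fin 3) : ⟪crossVec A, colVec A j⟫ = 0 := by
  rw [← det_appendCol]
  refine Matrix.det_zero_of_column_eq (Fin.castSucc_lt_last j).ne fun i => ?_
  rw [appendCol_castSucc, appendCol_last]
  rfl

/-- The Cauchy–Binet identity, read off from the corner entry of `adj (MᵀM') = adj M' (adj M)ᵀ`
with `M = [A 0]` and `M' = [A' 0]`. -/
theorem inner_crossVec_crossVec : ⟪crossVec A, crossVec A'⟫ = (Aᵀ * A').det := by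
  have corner : ((appendCol A 0)ᵀ * appendCol A' 0).submatrix Fin.castSucc Fin.castSucc =
      Aᵀ * A' := by
    ext i j
    simp [Matrix.mul_apply, appendCol]
  have cofactor := Matrix.adjugate_fin_succ_eq_det_submatrix
    ((appendCol A 0)ᵀ * appendCol A' 0) (Fin.last 3) (Fin.last 3)
  rw [Fin.succAbove_last, corner, Even.neg_one_pow ⟨_, rfl⟩, one_mul, Matrix.adjugate_mul_distrib,
    ← Matrix.adjugate_transpose] at cofactor
  exact cofactor

end CrossProduct

section ParallelogramArea

variable {E : Type*} [NormedAddCommGroup E] [InnerProductSpace ℝ E]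

/-- The area of the parallelogram spanned by two vectors, i.e. the norm of `u ∧ v`. -/
noncomputable def parallelogramArea (u v : E) : ℝ := √(‖u‖ ^ 2 * ‖v‖ ^ 2 - ⟪u, v⟫ ^ 2)

theorem parallelogramArea_nonneg (u v : E) : 0 ≤ parallelogramArea u v :=
  Real.sqrt_nonneg _

theorem parallelogramArea_sq (u v : E) :
    parallelogramArea u v ^ 2 = ‖u‖ ^ 2 * ‖v‖ ^ 2 - ⟪u, v⟫ ^ 2 := by
  refine Real.sq_sqrt ?_
  rw [sub_nonneg, ← mul_pow, sq_le_sq, abs_of_nonneg (a := ‖u‖ * ‖v‖) (by positivity)]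
  exact abs_real_inner_le_norm u v

theorem parallelogramArea_comm (u v : E) : parallelogramArea u v = parallelogramArea v u := by
  rw [parallelogramArea, parallelogramArea, real_inner_comm, mul_comm]

theorem parallelogramArea_smul_left (a : ℝ) (u v : E) :
    parallelogramArea (a • u) v = |a| * parallelogramArea u v := by
  rw [parallelogramArea, parallelogramArea, ← Real.sqrt_sq_eq_abs, ← Real.sqrt_mul (sq_nonneg _),
    norm_smul, real_inner_smul_left, mul_pow, Real.norm_eq_abs, sq_abs]
  ring_nf

theorem parallelogramArea_smul_right (a : ℝ) (u v : E) :
    parallelogramArea u (a • v) = |a| * parallelogramArea u v := by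
  rw [parallelogramArea_comm, parallelogramArea_smul_left, parallelogramArea_comm]

theorem parallelogramArea_pos {u v : E} (h : LinearIndependent ℝ ![u, v]) :
    0 < parallelogramArea u v := by
  have hu : u ≠ 0 := h.ne_zero 0
  refine Real.sqrt_pos.2 (sub_pos.2 ?_)
  rw [← mul_pow, sq_lt_sq, abs_of_nonneg (a := ‖u‖ * ‖v‖) (by positivity)]
  refine lt_of_le_of_ne (abs_real_inner_le_norm u v) fun heq => ?_
  obtain ⟨-, r, -, rfl⟩ := (abs_real_inner_div_norm_mul_norm_eq_one_iff u v).1 (by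
    have hv : v ≠ 0 := h.ne_zero 1
    rw [abs_div, abs_of_nonneg (a := ‖u‖ * ‖v‖) (by positivity), heq, div_self (by positivity)])
  exact (LinearIndependent.pair_iff' hu).1 h r rfl

theorem det_gram_pair (u v : E) :
    (Matrix.gram ℝ ![u, v]).det = parallelogramArea u v ^ 2 := by
  rw [parallelogramArea_sq, Matrix.det_fin_two]
  simp only [Matrix.gram_apply, Matrix.cons_val_zero, Matrix.cons_val_one,
    real_inner_self_eq_norm_sq, real_inner_comm u v]
  ring

theorem parallelogramArea_add_add_left {u v w : E} (hu : ⟪u, w⟫ = 0) (hv : ⟪v, w⟫ = 0) (s t : ℝ) :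
    parallelogramArea (s • u + t • v + w) u =
      √(t ^ 2 * parallelogramArea u v ^ 2 + ‖u‖ ^ 2 * ‖w‖ ^ 2) := by
  rw [parallelogramArea_sq, parallelogramArea]
  congr 1
  simp only [← real_inner_self_eq_norm_sq, inner_add_left, inner_add_right, real_inner_smul_left,
    real_inner_smul_right, hu, hv, real_inner_comm u v, real_inner_comm u w, real_inner_comm v w]
  ring

theorem mem_orthogonal_span_pair_iff {u v w : E} :
    w ∈ (Submodule.span ℝ (Set.range ![u, v]))ᗮ ↔ ⟪u, w⟫ = 0 ∧ ⟪v, w⟫ = 0 := by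
  have mem_span (i : Fin 2) : ![u, v] i ∈ Submodule.span ℝ (Set.range ![u, v]) :=
    Submodule.subset_span (Set.mem_range_self i)
  refine ⟨fun h => ⟨Submodule.inner_right_of_mem_orthogonal (mem_span 0) h,
    Submodule.inner_right_of_mem_orthogonal (mem_span 1) h⟩, ?_⟩
  rintro ⟨hu, hv⟩
  refine (Submodule.mem_orthogonal _ _).2 fun y hy => ?_
  obtain ⟨s, rfl⟩ := (Submodule.mem_span_range_iff_exists_fun ℝ).1 hy
  simp [Fin.sum_univ_two, inner_add_left, real_inner_smul_left, hu, hv]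

/-- Subtract from `n` its component in the plane of `u` and `v`. That component is orthogonal to
`u`, hence a multiple of `‖u‖² v - ⟪u, v⟫ u`. -/
theorem parallelogramArea_sq_mul_inner_starProjection [FiniteDimensional ℝ E] {u v n n' : E}
    (h : LinearIndependent ℝ ![u, v]) (hn : ⟪n, u⟫ = 0) (hn' : ⟪n', v⟫ = 0) :
    parallelogramArea u v ^ 2 *
        ⟪(Submodule.span ℝ (Set.range ![u, v]))ᗮ.starProjection n, n'⟫ =
      parallelogramArea u v ^ 2 * ⟪n, n'⟫ + ⟪u, v⟫ * ⟪n, v⟫ * ⟪n', u⟫ := by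
  have hA := (parallelogramArea_pos h).ne'
  have hA2 := parallelogramArea_sq u v
  set A := parallelogramArea u v
  set a := ⟪n, v⟫ / A ^ 2 with ha
  have mem_plane : a • (‖u‖ ^ 2 • v - ⟪u, v⟫ • u) ∈ Submodule.span ℝ (Set.range ![u, v]) :=
    Submodule.smul_mem _ _ <| Submodule.sub_mem _
      (Submodule.smul_mem _ _ <| Submodule.subset_span ⟨1, rfl⟩)
      (Submodule.smul_mem _ _ <| Submodule.subset_span ⟨0, rfl⟩)
  have mem_orthogonal : n - a • (‖u‖ ^ 2 • v - ⟪u, v⟫ • u) ∈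
      (Submodule.span ℝ (Set.range ![u, v]))ᗮ := by
    rw [mem_orthogonal_span_pair_iff]
    simp only [inner_sub_right, real_inner_smul_right, real_inner_self_eq_norm_sq,
      real_inner_comm n u, real_inner_comm n v, real_inner_comm u v, hn, ha]
    constructor
    · ring
    · field_simp
      rw [hA2]
      ring
  have projection : (Submodule.span ℝ (Set.range ![u, v]))ᗮ.starProjection n =
      n - a • (‖u‖ ^ 2 • v - ⟪u, v⟫ • u) :=
    Submodule.eq_starProjection_of_mem_orthogonal' mem_orthogonal
      (Submodule.le_orthogonal_orthogonal _ mem_plane) (by abel)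
  rw [projection]
  simp only [inner_sub_left, real_inner_smul_left, real_inner_comm n' u, real_inner_comm n' v, hn']
  rw [ha]
  field_simp
  ring

theorem normProjPerp_eq_parallelogramArea_div {v : EuclideanSpace ℝ (Fin 4)} (hv : v ≠ 0)
    (x : EuclideanSpace ℝ (Fin 4)) : normProjPerp v x = parallelogramArea v x / ‖v‖ := by
  have hv' : 0 < ‖v‖ := norm_pos_iff.2 hv
  have pythagoras := Submodule.norm_sq_eq_add_norm_sq_starProjection x (Submodule.span ℝ {v})
  rw [Submodule.starProjection_singleton, norm_smul, mul_pow, Real.norm_eq_abs, sq_abs,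
    RCLike.ofReal_real_eq_id, id] at pythagoras
  rw [normProjPerp, eq_div_iff hv'.ne',
    ← sq_eq_sq₀ (mul_nonneg (norm_nonneg _) hv'.le) (parallelogramArea_nonneg v x),
    parallelogramArea_sq, mul_pow,
    eq_sub_of_add_eq' pythagoras.symm]
  field_simp

end ParallelogramArea

section WeightedChangeOfVariables

open scoped ENNReal

variable {X Y Z : Type*} [MeasurableSpace X] [MeasurableSpace Y] [MeasurableSpace Z]

/-- `T` is a change of variables from `μ` to `ν` with Jacobian factor `J`: it transports the
measure `J μ` to `ν`. Neither injectivity nor smoothness of `T` is part of the notion. -/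
structure IsChangeOfVariables (T : X → Y) (J : X → ℝ) (μ : Measure X) (ν : Measure Y) : Prop where
  measurable_jacobian : Measurable J
  jacobian_nonneg : ∀ x, 0 ≤ J x
  measurePreserving : MeasurePreserving T (μ.withDensity fun x => ENNReal.ofReal (J x)) ν

namespace IsChangeOfVariables

variable {μ : Measure X} {ν : Measure Y} {τ : Measure Z} {S : X → Y} {T : Y → Z} {I : X → ℝ}
  {J : Y → ℝ}

theorem congr {S' : X → Y} {I' : X → ℝ} (hS : IsChangeOfVariables S I μ ν)
    (hS' : ∀ x, S' x = S x) (hI' : ∀ x, I' x = I x) : IsChangeOfVariables S' I' μ ν := by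
  rwa [funext hS', funext hI']

theorem of_measurePreserving (hS : MeasurePreserving S μ ν) :
    IsChangeOfVariables S (fun _ => 1) μ ν where
  measurable_jacobian := measurable_const
  jacobian_nonneg _ := zero_le_one
  measurePreserving := by
    simpa only [ENNReal.ofReal_one, ← Pi.one_def, withDensity_one] using hS

theorem comp (hT : IsChangeOfVariables T J ν τ) (hS : IsChangeOfVariables S I μ ν) :
    IsChangeOfVariables (T ∘ S) (fun x => I x * J (S x)) μ τ where
  measurable_jacobian := hS.measurable_jacobian.mul
    (hT.measurable_jacobian.comp hS.measurePreserving.measurable)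
  jacobian_nonneg x := mul_nonneg (hS.jacobian_nonneg x) (hT.jacobian_nonneg (S x))
  measurePreserving := by
    have measurable_S := hS.measurePreserving.measurable
    have measurable_I := hS.measurable_jacobian.ennreal_ofReal
    have measurable_J := hT.measurable_jacobian.ennreal_ofReal
    have density_mul : (fun x => ENNReal.ofReal (I x * J (S x))) =
        (fun x => ENNReal.ofReal (I x)) * (fun y => ENNReal.ofReal (J y)) ∘ S :=
      funext fun x => ENNReal.ofReal_mul (hS.jacobian_nonneg x)
    rw [density_mul, withDensity_mul _ measurable_I (measurable_J.comp measurable_S)]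
    refine hT.measurePreserving.comp ⟨measurable_S, Measure.ext fun s hs => ?_⟩
    rw [Measure.map_apply measurable_S hs, withDensity_apply _ (measurable_S hs),
      withDensity_apply _ hs]
    exact hS.measurePreserving.setLIntegral_comp_preimage hs measurable_J

theorem integrable_comp_iff (hS : IsChangeOfVariables S I μ ν) {f : Y → ℝ}
    (hf : AEStronglyMeasurable f ν) :
    Integrable (fun x => I x * f (S x)) μ ↔ Integrable f ν := by
  rw [← hS.measurePreserving.integrable_comp hf, integrable_withDensity_iff_integrable_smul'
    hS.measurable_jacobian.ennreal_ofReal (.of_forall fun _ => ENNReal.ofReal_lt_top)]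
  simp only [ENNReal.toReal_ofReal (hS.jacobian_nonneg _), smul_eq_mul, Function.comp_apply]

theorem integral_comp (hS : IsChangeOfVariables S I μ ν) {f : Y → ℝ}
    (hf : AEStronglyMeasurable f ν) : ∫ x, I x * f (S x) ∂μ = ∫ y, f y ∂ν := by
  rw [← hS.measurePreserving.map_eq] at hf ⊢
  rw [integral_map hS.measurePreserving.aemeasurable hf,
    integral_withDensity_eq_integral_toReal_smul hS.measurable_jacobian.ennreal_ofReal
      (.of_forall fun _ => ENNReal.ofReal_lt_top)]
  simp only [ENNReal.toReal_ofReal (hS.jacobian_nonneg _), smul_eq_mul]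

theorem prodMap_id [SFinite μ] [SFinite ν] (hS : IsChangeOfVariables S I μ ν) (τ : Measure Z)
    [SFinite τ] :
    IsChangeOfVariables (Prod.map S id) (fun z => I z.1) (μ.prod τ) (ν.prod τ) where
  measurable_jacobian := hS.measurable_jacobian.comp measurable_fst
  jacobian_nonneg z := hS.jacobian_nonneg z.1
  measurePreserving := by
    rw [← prod_withDensity_left hS.measurable_jacobian.ennreal_ofReal]
    exact hS.measurePreserving.prod (MeasurePreserving.id τ)

end IsChangeOfVariables

variable {V : Type*} [NormedAddCommGroup V] [NormedSpace ℝ V] [FiniteDimensional ℝ V]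
  [MeasurableSpace V] [BorelSpace V]

theorem lintegral_comp_smul_of_ne_zero (μ : Measure V) [μ.IsAddHaarMeasure] {f : V → ℝ≥0∞}
    (hf : Measurable f) {r : ℝ} (hr : r ≠ 0) :
    ENNReal.ofReal (|r| ^ finrank ℝ V) * ∫⁻ v, f (r • v) ∂μ = ∫⁻ v, f v ∂μ := by
  rw [← lintegral_map hf (measurable_const_smul r), Measure.map_addHaar_smul μ hr,
    lintegral_smul_measure, smul_eq_mul, ← mul_assoc, ← ENNReal.ofReal_mul (by positivity),
    abs_inv, abs_pow, mul_inv_cancel₀ (by positivity), ENNReal.ofReal_one, one_mul]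

theorem isChangeOfVariables_fiberwise_smul {ν : Measure Y} [SFinite ν] {μ : Measure V}
    [μ.IsAddHaarMeasure] {r : Y → ℝ} (hr : Measurable r) (hr0 : ∀ᵐ y ∂ν, r y ≠ 0) :
    IsChangeOfVariables (fun z : Y × V => (z.1, r z.1 • z.2)) (fun z => |r z.1| ^ finrank ℝ V)
      (ν.prod μ) (ν.prod μ) where
  measurable_jacobian := by fun_prop
  jacobian_nonneg z := by positivity
  measurePreserving := by
    refine ⟨by fun_prop, Measure.ext_of_lintegral _ fun f hf => ?_⟩
    have measurable_comp : Measurable fun z : Y × V => f (z.1, r z.1 • z.2) := by fun_prop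
    rw [lintegral_map hf (by fun_prop),
      lintegral_withDensity_eq_lintegral_mul _ (by fun_prop) measurable_comp,
      lintegral_prod _ (by fun_prop), lintegral_prod _ hf.aemeasurable]
    refine lintegral_congr_ae (hr0.mono fun y hy => ?_)
    simp only [Pi.mul_apply]
    rw [lintegral_const_mul _ (by fun_prop)]
    exact lintegral_comp_smul_of_ne_zero μ (hf.comp measurable_prodMk_left) hy

theorem isChangeOfVariables_mulVec {ι : Type*} [Fintype ι] [DecidableEq ι] {M : Matrix ι ι ℝ}
    (hM : M.det ≠ 0) :
    IsChangeOfVariables (fun x => M *ᵥ x) (fun _ => |M.det|) volume volume where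
  measurable_jacobian := measurable_const
  jacobian_nonneg _ := abs_nonneg _
  measurePreserving := by
    refine ⟨by fun_prop, ?_⟩
    rw [withDensity_const, Measure.map_smul]
    refine (congrArg _ (Real.map_matrix_volume_pi_eq_smul_volume_pi hM)).trans ?_
    rw [smul_smul, ← ENNReal.ofReal_mul (abs_nonneg _), ← abs_mul, mul_inv_cancel₀ hM, abs_one,
      ENNReal.ofReal_one, one_smul]

end WeightedChangeOfVariables

section SlopeCoordinates

variable {E : Type*} [NormedAddCommGroup E] [InnerProductSpace ℝ E]

/-- The point at distance `‖y‖` from the origin on the ray through `‖y‖ x + y`. For `x` in a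
subspace and `y` in its orthogonal complement, `x` is the slope of this ray over the complement. -/
noncomputable def slopePoint (x y : E) : E := (√(1 + ‖x‖ ^ 2))⁻¹ • (‖y‖ • x + y)

theorem norm_slopePoint {x y : E} (h : ⟪x, y⟫ = 0) : ‖slopePoint x y‖ = ‖y‖ := by
  have pythagoras : ‖‖y‖ • x + y‖ = √(1 + ‖x‖ ^ 2) * ‖y‖ := by
    rw [← sq_eq_sq₀ (norm_nonneg _) (by positivity), mul_pow, Real.sq_sqrt (by positivity),
      norm_add_sq_real, norm_smul, norm_norm, real_inner_smul_left, h]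
    ring
  rw [slopePoint, norm_smul, pythagoras, norm_inv, Real.norm_of_nonneg (Real.sqrt_nonneg _),
    inv_mul_cancel_left₀ (by positivity)]

variable [FiniteDimensional ℝ E] [MeasurableSpace E] [BorelSpace E]

theorem isChangeOfVariables_sum_smul_basis {ι : Type*} [Fintype ι] [DecidableEq ι]
    (b : Basis ι ℝ E) :
    IsChangeOfVariables (fun x : ι → ℝ => ∑ i, x i • b i) (fun _ => √(Matrix.gram ℝ b).det)
      volume volume := by
  let o : OrthonormalBasis ι ℝ E := (stdOrthonormalBasis ℝ E).reindex
    (Fintype.equivFinOfCardEq (finrank_eq_card_basis b).symm).symm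
  have gram_eq : (Matrix.gram ℝ b).det = (o.toBasis.toMatrix b).det ^ 2 := by
    rw [Matrix.gram_eq_conjTranspose_mul o, Matrix.det_mul, Matrix.det_conjTranspose, star_trivial,
      sq]
    rfl
  have det_ne_zero : (o.toBasis.toMatrix b).det ≠ 0 := (o.toBasis.isUnit_det b).ne_zero
  have isometry : MeasurePreserving (fun x : ι → ℝ => o.repr.symm (WithLp.toLp 2 x)) :=
    o.measurePreserving_repr_symm.comp (PiLp.volume_preserving_toLp ι)
  refine ((IsChangeOfVariables.of_measurePreserving isometry).comp
    (isChangeOfVariables_mulVec det_ne_zero)).congr (fun x => ?_) fun x => ?_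
  · rw [Function.comp_apply, LinearIsometryEquiv.eq_symm_apply]
    ext j
    simp [Matrix.mulVec, dotProduct, Basis.toMatrix_apply, mul_comm]
  · rw [gram_eq, Real.sqrt_sq_eq_abs, mul_one]

theorem measurePreserving_add_orthogonal (K : Submodule ℝ E) :
    MeasurePreserving (fun z : K × Kᗮ => (z.1 + z.2 : E)) := by
  convert K.orthogonalDecomposition.symm.measurePreserving.comp
    (WithLp.volume_preserving_toLp K Kᗮ) using 1
  ext z
  simp

theorem isChangeOfVariables_slopePoint (K : Submodule ℝ E) [Nontrivial Kᗮ] :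
    IsChangeOfVariables (fun z : K × Kᗮ => slopePoint (z.1 : E) (z.2 : E))
      (fun z => ‖z.2‖ ^ finrank ℝ K / √(1 + ‖z.1‖ ^ 2) ^ finrank ℝ E) volume volume := by
  have shrink := isChangeOfVariables_fiberwise_smul (ν := (volume : Measure K))
    (μ := (volume : Measure Kᗮ)) (r := fun x => (√(1 + ‖x‖ ^ 2))⁻¹) (by fun_prop)
    (.of_forall fun x => by positivity)
  have ae_ne : ∀ᵐ y : Kᗮ, y ≠ 0 := Measure.ae_ne volume 0
  have stretch := isChangeOfVariables_fiberwise_smul (ν := (volume : Measure Kᗮ))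
    (μ := (volume : Measure K)) (r := fun y => ‖y‖) (by fun_prop)
    (ae_ne.mono fun y hy => norm_ne_zero_iff.2 hy)
  have swap_add := (measurePreserving_add_orthogonal K).comp
    (Measure.measurePreserving_swap (μ := (volume : Measure Kᗮ)) (ν := (volume : Measure K)))
  refine (((IsChangeOfVariables.of_measurePreserving swap_add).comp stretch).comp
    ((IsChangeOfVariables.of_measurePreserving Measure.measurePreserving_swap).comp
      shrink)).congr (fun z => ?_) fun z => ?_
  · simp [slopePoint, norm_smul, smul_smul, abs_of_nonneg]
  · have sqrt_pos : 0 < √(1 + ‖z.1‖ ^ 2) := by positivity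
    simp only [Function.comp_apply, Prod.fst_swap, norm_smul, norm_inv, Real.norm_eq_abs, abs_mul,
      abs_inv, abs_norm, abs_of_pos sqrt_pos, mul_one]
    rw [← K.finrank_add_finrank_orthogonal, mul_pow, pow_add, inv_pow, inv_pow]
    field_simp

theorem isChangeOfVariables_slopePoint_span {ι : Type*} [Fintype ι] [DecidableEq ι] {f : ι → E}
    (hf : LinearIndependent ℝ f) [Nontrivial (Submodule.span ℝ (Set.range f))ᗮ] :
    IsChangeOfVariables
      (fun z : (ι → ℝ) × (Submodule.span ℝ (Set.range f))ᗮ =>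
        slopePoint (∑ i, z.1 i • f i) (z.2 : E))
      (fun z => √(Matrix.gram ℝ f).det *
        (‖z.2‖ ^ Fintype.card ι / √(1 + ‖∑ i, z.1 i • f i‖ ^ 2) ^ finrank ℝ E))
      volume volume := by
  have coordinates := isChangeOfVariables_sum_smul_basis (Basis.span hf)
  have coe_sum (x : ι → ℝ) :
      ((∑ i, x i • Basis.span hf i : Submodule.span ℝ (Set.range f)) : E) = ∑ i, x i • f i := by
    simp [Basis.span_apply]
  have gram_eq : Matrix.gram ℝ (Basis.span hf) = Matrix.gram ℝ f := by
    ext i j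
    simp [Matrix.gram_apply, Basis.span_apply]
  refine ((isChangeOfVariables_slopePoint _).comp (coordinates.prodMap_id volume)).congr
    (fun z => ?_) fun z => ?_
  · simp only [Function.comp_apply, Prod.map_fst, Prod.map_snd, id, coe_sum]
  · simp only [Prod.map_fst, Prod.map_snd, id, gram_eq, Submodule.coe_norm, coe_sum,
      finrank_eq_card_basis (Basis.span hf)]

end SlopeCoordinates

section SlopeWeight

theorem hasDerivAt_sin_arctan (a : ℝ) :
    HasDerivAt (fun a => sin (arctan a)) (√(1 + a ^ 2) ^ 3)⁻¹ a := by
  refine (hasDerivAt_arctan a).sin.congr_deriv ?_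
  have sq_sqrt : √(1 + a ^ 2) ^ 2 = 1 + a ^ 2 := Real.sq_sqrt (by positivity)
  rw [cos_arctan, ← sq_sqrt, Real.sqrt_sq (by positivity)]
  field_simp

theorem abs_mul_add_mul_inv_sqrt_cubed_le (s t a : ℝ) :
    |(s * a + t) * (√(1 + a ^ 2) ^ 3)⁻¹| ≤ (|s| + |t|) * (1 + a ^ 2)⁻¹ := by
  have sq_sqrt : √(1 + a ^ 2) ^ 2 = 1 + a ^ 2 := Real.sq_sqrt (by positivity)
  have abs_le : |a| ≤ √(1 + a ^ 2) := abs_le_sqrt (by linarith)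
  have one_le : 1 ≤ √(1 + a ^ 2) := one_le_sqrt.2 (by linarith [sq_nonneg a])
  have linear : |s * a + t| ≤ (|s| + |t|) * √(1 + a ^ 2) := calc
    |s * a + t| ≤ |s| * |a| + |t| * 1 := by rw [← abs_mul, mul_one]; exact abs_add_le _ _
    _ ≤ (|s| + |t|) * √(1 + a ^ 2) := by rw [add_mul]; gcongr
  calc |(s * a + t) * (√(1 + a ^ 2) ^ 3)⁻¹| = |s * a + t| * (√(1 + a ^ 2) ^ 3)⁻¹ := by
        rw [abs_mul, abs_of_nonneg (a := (√(1 + a ^ 2) ^ 3)⁻¹) (by positivity)]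
    _ ≤ (|s| + |t|) * √(1 + a ^ 2) * (√(1 + a ^ 2) ^ 3)⁻¹ := by gcongr
    _ = (|s| + |t|) * (√(1 + a ^ 2) ^ 2)⁻¹ := by field_simp
    _ = (|s| + |t|) * (1 + a ^ 2)⁻¹ := by rw [sq_sqrt]

theorem integrable_mul_add_mul_inv_sqrt_cubed (s t : ℝ) :
    Integrable fun a : ℝ => (s * a + t) * (√(1 + a ^ 2) ^ 3)⁻¹ :=
  (integrable_inv_one_add_sq.const_mul (|s| + |t|)).mono' (by fun_prop)
    (.of_forall (abs_mul_add_mul_inv_sqrt_cubed_le s t))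

theorem integral_inv_sqrt_cubed : ∫ a : ℝ, (√(1 + a ^ 2) ^ 3)⁻¹ = 2 := by
  have at_bot : Filter.Tendsto (fun a => sin (arctan a)) Filter.atBot (nhds (sin (-(π / 2)))) :=
    (continuous_sin.tendsto _).comp (tendsto_arctan_atBot.mono_right nhdsWithin_le_nhds)
  have at_top : Filter.Tendsto (fun a => sin (arctan a)) Filter.atTop (nhds (sin (π / 2))) :=
    (continuous_sin.tendsto _).comp (tendsto_arctan_atTop.mono_right nhdsWithin_le_nhds)
  rw [integral_of_hasDerivAt_of_tendsto hasDerivAt_sin_arctan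
    (by simpa using integrable_mul_add_mul_inv_sqrt_cubed 0 1) at_bot at_top, sin_neg,
    sin_pi_div_two]
  norm_num

theorem integral_mul_add_mul_inv_sqrt_cubed (s t : ℝ) :
    ∫ a : ℝ, (s * a + t) * (√(1 + a ^ 2) ^ 3)⁻¹ = 2 * t := by
  have odd_part : ∫ a : ℝ, a * (√(1 + a ^ 2) ^ 3)⁻¹ = 0 := by
    rw [← self_eq_neg, ← integral_neg, ← integral_neg_eq_self]
    simp only [neg_mul, neg_sq]
  have integrable_odd : Integrable fun a : ℝ => a * (√(1 + a ^ 2) ^ 3)⁻¹ := by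
    simpa using integrable_mul_add_mul_inv_sqrt_cubed 1 0
  have integrable_even : Integrable fun a : ℝ => (√(1 + a ^ 2) ^ 3)⁻¹ := by
    simpa using integrable_mul_add_mul_inv_sqrt_cubed 0 1
  simp only [add_mul, mul_assoc]
  rw [integral_add (integrable_odd.const_mul s) (integrable_even.const_mul t), integral_const_mul,
    integral_const_mul, odd_part, integral_inv_sqrt_cubed]
  ring

theorem integral_prod_mul_add_mul_inv_sqrt_cubed {ι : Type*} [Fintype ι] (s t : ι → ℝ) :
    ∫ x : ι → ℝ, ∏ i, (s i * x i + t i) * (√(1 + x i ^ 2) ^ 3)⁻¹ = ∏ i, 2 * t i := by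
  rw [integral_fintype_prod_volume_eq_prod fun i (a : ℝ) =>
    (s i * a + t i) * (√(1 + a ^ 2) ^ 3)⁻¹]
  simp only [integral_mul_add_mul_inv_sqrt_cubed]

end SlopeWeight

section GaussianMoments

variable {V : Type*} [NormedAddCommGroup V] [InnerProductSpace ℝ V]

theorem hasFDerivAt_exp_neg_sq_norm (v : V) :
    HasFDerivAt (fun v : V => rexp (-‖v‖ ^ 2 / 2)) (-rexp (-‖v‖ ^ 2 / 2) • innerSL ℝ v) v := by
  refine ((hasStrictFDerivAt_norm_sq v).hasFDerivAt.neg.mul_const (2⁻¹ : ℝ)).exp.congr_fderiv ?_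
  ext w
  simp [div_eq_mul_inv]

variable [FiniteDimensional ℝ V] [MeasurableSpace V] [BorelSpace V]

theorem integrable_exp_neg_mul_sq_norm {b : ℝ} (hb : 0 < b) :
    Integrable fun v : V => rexp (-b * ‖v‖ ^ 2) := by
  refine Integrable.of_integral_ne_zero ?_
  rw [GaussianFourier.integral_rexp_neg_mul_sq_norm hb]
  positivity

theorem integrable_mul_exp_of_abs_le {f : V → ℝ} (hf : AEStronglyMeasurable f) {C : ℝ}
    (hC : ∀ v, |f v| ≤ C * (1 + ‖v‖ ^ 2)) :
    Integrable fun v => f v * rexp (-‖v‖ ^ 2 / 2) := by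
  have C_nonneg : 0 ≤ C := by simpa using (abs_nonneg _).trans (hC 0)
  refine ((integrable_exp_neg_mul_sq_norm (V := V) (b := 1 / 4) (by norm_num)).const_mul
    (C * 4)).mono' (hf.mul (by fun_prop)) (.of_forall fun v => ?_)
  have quadratic_le_exp : 1 + ‖v‖ ^ 2 ≤ 4 * rexp (1 / 4 * ‖v‖ ^ 2) := by
    linarith [add_one_le_exp (1 / 4 * ‖v‖ ^ 2)]
  calc ‖f v * rexp (-‖v‖ ^ 2 / 2)‖ = |f v| * rexp (-‖v‖ ^ 2 / 2) := by
        rw [norm_mul, norm_eq_abs, norm_eq_abs, abs_exp]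
    _ ≤ C * (1 + ‖v‖ ^ 2) * rexp (-‖v‖ ^ 2 / 2) := by gcongr; exact hC v
    _ ≤ C * (4 * rexp (1 / 4 * ‖v‖ ^ 2)) * rexp (-‖v‖ ^ 2 / 2) := by gcongr
    _ = C * 4 * rexp (-(1 / 4) * ‖v‖ ^ 2) := by
        rw [← mul_assoc, mul_assoc, ← exp_add]
        ring_nf

theorem integral_exp_neg_sq_norm :
    ∫ v : V, rexp (-‖v‖ ^ 2 / 2) = (2 * π) ^ (finrank ℝ V / 2 : ℝ) := calc
  ∫ v : V, rexp (-‖v‖ ^ 2 / 2) = ∫ v : V, rexp (-(1 / 2) * ‖v‖ ^ 2) := by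
    congr! 3
    ring
  _ = (π / (1 / 2)) ^ (finrank ℝ V / 2 : ℝ) :=
    GaussianFourier.integral_rexp_neg_mul_sq_norm one_half_pos
  _ = (2 * π) ^ (finrank ℝ V / 2 : ℝ) := by rw [div_div_eq_mul_div, div_one, mul_comm]

theorem integrable_inner_mul_exp (e : V) :
    Integrable fun v : V => ⟪e, v⟫ * rexp (-‖v‖ ^ 2 / 2) :=
  integrable_mul_exp_of_abs_le (C := ‖e‖) (by fun_prop) fun v =>
    (abs_real_inner_le_norm e v).trans (by gcongr; linarith [sq_nonneg (‖v‖ - 1), sq_nonneg ‖v‖])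

theorem integrable_inner_mul_inner_mul_exp (e e' : V) :
    Integrable fun v : V => ⟪e, v⟫ * ⟪e', v⟫ * rexp (-‖v‖ ^ 2 / 2) := by
  refine integrable_mul_exp_of_abs_le (C := ‖e‖ * ‖e'‖) (by fun_prop) fun v => ?_
  calc |⟪e, v⟫ * ⟪e', v⟫| ≤ ‖e‖ * ‖v‖ * (‖e'‖ * ‖v‖) := by
        rw [abs_mul]
        gcongr <;> exact abs_real_inner_le_norm _ _
    _ = ‖e‖ * ‖e'‖ * ‖v‖ ^ 2 := by ring
    _ ≤ ‖e‖ * ‖e'‖ * (1 + ‖v‖ ^ 2) := by gcongr; linarith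

/-- Integrate by parts, using that `-⟪e', v⟫ exp (-‖v‖² / 2)` is the derivative of the Gaussian in
the direction `e'`. -/
theorem integral_inner_mul_inner_mul_exp (e e' : V) :
    ∫ v : V, ⟪e, v⟫ * ⟪e', v⟫ * rexp (-‖v‖ ^ 2 / 2) =
      (2 * π) ^ (finrank ℝ V / 2 : ℝ) * ⟪e, e'⟫ := by
  have integrable_gaussian : Integrable fun v : V => rexp (-‖v‖ ^ 2 / 2) :=
    .of_integral_ne_zero (by rw [integral_exp_neg_sq_norm]; positivity)
  have derivative (v : V) : ⟪e, v⟫ * (-rexp (-‖v‖ ^ 2 / 2) • innerSL ℝ v) e' =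
      -(⟪e, v⟫ * ⟪e', v⟫ * rexp (-‖v‖ ^ 2 / 2)) := by
    rw [smul_apply, innerSL_apply_apply, real_inner_comm e' v, smul_eq_mul]
    ring
  have by_parts := integral_bilinear_hasFDerivAt_right_eq_neg_left_of_integrable
    (B := ContinuousLinearMap.mul ℝ ℝ) (μ := volume) (v := e')
    (integrable_gaussian.const_mul ⟪e, e'⟫)
    ((integrable_inner_mul_inner_mul_exp e e').neg.congr
      (.of_forall fun v => (derivative v).symm))
    (integrable_inner_mul_exp e)
    (fun v _ => (innerSL ℝ e).hasFDerivAt) (fun v _ => hasFDerivAt_exp_neg_sq_norm v)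
  simp only [ContinuousLinearMap.mul_apply', innerSL_apply_apply, derivative, integral_neg,
    neg_inj, integral_const_mul, integral_exp_neg_sq_norm] at by_parts
  rw [by_parts, mul_comm]

end GaussianMoments

section SeparatedKernel

variable {V : Type*} [NormedAddCommGroup V] [InnerProductSpace ℝ V]

/-- A quadratic form in the slopes `x` and the vector `y`, weighted by `(1 + x i ^ 2) ^ (-3 / 2)`
in each slope and by the Gaussian in `y`. It is the shape that `linkKernel` takes in slope
coordinates. -/
noncomputable def separatedKernel (s : Fin 2 → ℝ) (e : Fin 2 → V) (z : (Fin 2 → ℝ) × V) : ℝ :=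
  (∏ i, (‖z.2‖ * s i * z.1 i + ⟪e i, z.2⟫) * (√(1 + z.1 i ^ 2) ^ 3)⁻¹) * rexp (-‖z.2‖ ^ 2 / 2)

variable (s : Fin 2 → ℝ) (e : Fin 2 → V)

theorem abs_separatedKernel_le (z : (Fin 2 → ℝ) × V) :
    |separatedKernel s e z| ≤
      (∏ i, (|s i| + ‖e i‖) * (1 + z.1 i ^ 2)⁻¹) * (‖z.2‖ ^ 2 * rexp (-‖z.2‖ ^ 2 / 2)) := by
  obtain ⟨x, y⟩ := z
  have factor_le (i : Fin 2) : |(‖y‖ * s i * x i + ⟪e i, y⟫) * (√(1 + x i ^ 2) ^ 3)⁻¹| ≤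
      (|s i| + ‖e i‖) * (1 + x i ^ 2)⁻¹ * ‖y‖ := calc
    _ ≤ (|‖y‖ * s i| + |⟪e i, y⟫|) * (1 + x i ^ 2)⁻¹ := abs_mul_add_mul_inv_sqrt_cubed_le _ _ _
    _ ≤ (‖y‖ * |s i| + ‖e i‖ * ‖y‖) * (1 + x i ^ 2)⁻¹ := by
      rw [abs_mul, abs_norm]
      gcongr
      exact abs_real_inner_le_norm _ _
    _ = (|s i| + ‖e i‖) * (1 + x i ^ 2)⁻¹ * ‖y‖ := by ring
  calc |separatedKernel s e (x, y)|
      ≤ (∏ i, (|s i| + ‖e i‖) * (1 + x i ^ 2)⁻¹ * ‖y‖) * rexp (-‖y‖ ^ 2 / 2) := by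
        rw [separatedKernel, abs_mul, abs_exp, Finset.abs_prod]
        gcongr with i
        exact factor_le i
    _ = _ := by rw [Finset.prod_mul_distrib, Finset.prod_const, Finset.card_fin, mul_assoc]

variable [FiniteDimensional ℝ V] [MeasurableSpace V] [BorelSpace V]

theorem integrable_separatedKernel : Integrable (separatedKernel s e) := by
  have integrable_slopes : Integrable fun x : Fin 2 → ℝ =>
      ∏ i, (|s i| + ‖e i‖) * (1 + x i ^ 2)⁻¹ :=
    Integrable.fintype_prod (f := fun i a => (|s i| + ‖e i‖) * (1 + a ^ 2)⁻¹) fun i =>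
      integrable_inv_one_add_sq.const_mul _
  have integrable_gaussian : Integrable fun y : V => ‖y‖ ^ 2 * rexp (-‖y‖ ^ 2 / 2) :=
    integrable_mul_exp_of_abs_le (C := 1) (by fun_prop) fun y => by
      rw [abs_of_nonneg (sq_nonneg _)]
      linarith
  exact (integrable_slopes.mul_prod integrable_gaussian).mono'
    (by unfold separatedKernel; fun_prop) (.of_forall (abs_separatedKernel_le s e))

theorem integral_separatedKernel :
    ∫ z, separatedKernel s e z = 4 * (2 * π) ^ (finrank ℝ V / 2 : ℝ) * ⟪e 0, e 1⟫ := calc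
  ∫ z, separatedKernel s e z = ∫ y : V, ∫ x, separatedKernel s e (x, y) :=
    integral_prod_symm _ (integrable_separatedKernel s e)
  _ = ∫ y : V, (∏ i, 2 * ⟪e i, y⟫) * rexp (-‖y‖ ^ 2 / 2) := by
    simp only [separatedKernel, integral_mul_const, integral_prod_mul_add_mul_inv_sqrt_cubed]
  _ = ∫ y : V, 4 * (⟪e 0, y⟫ * ⟪e 1, y⟫ * rexp (-‖y‖ ^ 2 / 2)) := by
    congr! 2 with y
    rw [Fin.prod_univ_two]
    ring
  _ = 4 * (2 * π) ^ (finrank ℝ V / 2 : ℝ) * ⟪e 0, e 1⟫ := by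
    rw [integral_const_mul, integral_inner_mul_inner_mul_exp, mul_assoc]

end SeparatedKernel

section LinkKernel

variable {E : Type*} [NormedAddCommGroup E] [InnerProductSpace ℝ E]

/-- The Gaussian linking integrand, with `n` and `n'` the cross products of the columns of the two
matrices and `c` and `d` their last columns. -/
noncomputable def linkKernel (n n' c d v : E) : ℝ :=
  ⟪n, v⟫ * ⟪n', v⟫ * ‖v‖ ^ 4 / (parallelogramArea v c ^ 3 * parallelogramArea v d ^ 3) *
    rexp (-‖v‖ ^ 2 / 2)

theorem linkIntegrand_eq_linkKernel (A A' : Matrix (Fin 4) (Fin 3) ℝ) :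
    linkIntegrand A A' =
      linkKernel (crossVec A) (crossVec A') (colVec A 2) (colVec A' 2) := by
  ext v
  rcases eq_or_ne v 0 with rfl | hv
  · simp [linkIntegrand, linkKernel, det_appendCol]
  · have norm_ne_zero : ‖v‖ ≠ 0 := norm_ne_zero_iff.2 hv
    rw [linkIntegrand, linkKernel, det_appendCol, det_appendCol, real_inner_smul_right,
      real_inner_smul_right, normProjPerp_eq_parallelogramArea_div hv,
      normProjPerp_eq_parallelogramArea_div hv]
    congr 1
    field_simp

theorem linkKernel_smul_smul (n n' c d v : E) (a b : ℝ) :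
    linkKernel n n' (a • c) (b • d) v = (|a * b| ^ 3)⁻¹ * linkKernel n n' c d v := by
  rw [linkKernel, linkKernel, parallelogramArea_smul_right, parallelogramArea_smul_right, abs_mul]
  ring

theorem parallelogramArea_slopePoint_left {p q y : E} (hpy : ⟪p, y⟫ = 0) (hqy : ⟪q, y⟫ = 0)
    (hp : ‖p‖ = parallelogramArea p q) (s t : ℝ) :
    parallelogramArea (slopePoint (s • p + t • q) y) p =
      (√(1 + ‖s • p + t • q‖ ^ 2))⁻¹ * (‖y‖ * ‖p‖ * √(1 + t ^ 2)) := by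
  have cone_area : parallelogramArea (‖y‖ • (s • p + t • q) + y) p = ‖y‖ * ‖p‖ * √(1 + t ^ 2) := by
    rw [smul_add, smul_smul, smul_smul, parallelogramArea_add_add_left hpy hqy, ← hp,
      ← Real.sqrt_sq (by positivity : 0 ≤ ‖y‖ * ‖p‖), ← Real.sqrt_mul (by positivity)]
    ring_nf
  rw [slopePoint, parallelogramArea_smul_left, cone_area, abs_of_nonneg (by positivity)]

/-- In dimension `4` the powers of `√(1 + ‖x 0 • p + x 1 • q‖ ^ 2)` cancel. -/
theorem jacobian_mul_linkKernel_slopePoint {n n' p q y : E} (hnp : ⟪n, p⟫ = 0) (hn'q : ⟪n', q⟫ = 0)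
    (hpy : ⟪p, y⟫ = 0) (hqy : ⟪q, y⟫ = 0) (hp : ‖p‖ = parallelogramArea p q)
    (hq : ‖q‖ = parallelogramArea p q) (hpq : 0 < parallelogramArea p q) (s t : ℝ) :
    parallelogramArea p q * (‖y‖ ^ 2 / √(1 + ‖s • p + t • q‖ ^ 2) ^ 4) *
        linkKernel n n' p q (slopePoint (s • p + t • q) y) =
      (parallelogramArea p q ^ 5)⁻¹ *
        (((‖y‖ * ⟪n', p⟫ * s + ⟪n', y⟫) * (√(1 + s ^ 2) ^ 3)⁻¹ *
          ((‖y‖ * ⟪n, q⟫ * t + ⟪n, y⟫) * (√(1 + t ^ 2) ^ 3)⁻¹)) * rexp (-‖y‖ ^ 2 / 2)) := by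
  have orthogonal : ⟪s • p + t • q, y⟫ = 0 := by
    simp only [inner_add_left, real_inner_smul_left, hpy, hqy, mul_zero, add_zero]
  have area_p := parallelogramArea_slopePoint_left hpy hqy hp s t
  have area_q := parallelogramArea_slopePoint_left hqy hpy
    (hq.trans (parallelogramArea_comm p q)) t s
  rw [add_comm (t • q)] at area_q
  rw [linkKernel, area_p, area_q, norm_slopePoint orthogonal, hp, hq]
  simp only [slopePoint, real_inner_smul_right, inner_add_right, hnp, hn'q]
  rcases eq_or_ne y 0 with rfl | hy
  · simp
  · have norm_ne_zero : ‖y‖ ≠ 0 := norm_ne_zero_iff.2 hy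
    field_simp
    ring

variable [FiniteDimensional ℝ E]

theorem jacobian_mul_linkKernel_eq_separatedKernel {n n' p q : E} (hnp : ⟪n, p⟫ = 0)
    (hn'q : ⟪n', q⟫ = 0) (hp : ‖p‖ = parallelogramArea p q) (hq : ‖q‖ = parallelogramArea p q)
    (hpq : 0 < parallelogramArea p q) (z : (Fin 2 → ℝ) × (Submodule.span ℝ (Set.range ![p, q]))ᗮ) :
    √(Matrix.gram ℝ ![p, q]).det *
          (‖z.2‖ ^ Fintype.card (Fin 2) / √(1 + ‖∑ i, z.1 i • ![p, q] i‖ ^ 2) ^ 4) *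
        linkKernel n n' p q (slopePoint (∑ i, z.1 i • ![p, q] i) z.2) =
      (parallelogramArea p q ^ 5)⁻¹ *
        separatedKernel ![⟪n', p⟫, ⟪n, q⟫]
          ![(Submodule.span ℝ (Set.range ![p, q]))ᗮ.orthogonalProjectionOnto n',
            (Submodule.span ℝ (Set.range ![p, q]))ᗮ.orthogonalProjectionOnto n] z := by
  obtain ⟨x, y⟩ := z
  obtain ⟨hpy, hqy⟩ := mem_orthogonal_span_pair_iff.1 y.2
  rw [det_gram_pair, Real.sqrt_sq hpq.le, Fintype.card_fin, separatedKernel]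
  simp only [Fin.sum_univ_two, Fin.prod_univ_two, Matrix.cons_val_zero, Matrix.cons_val_one,
    Submodule.inner_orthogonalProjectionOnto_eq_of_mem_right]
  exact jacobian_mul_linkKernel_slopePoint hnp hn'q hpy hqy hp hq hpq (x 0) (x 1)

variable [MeasurableSpace E] [BorelSpace E]

theorem measurable_linkKernel (n n' c d : E) : Measurable (linkKernel n n' c d) := by
  unfold linkKernel parallelogramArea
  fun_prop

theorem integrable_and_integral_linkKernel_of_norm_eq (hE : finrank ℝ E = 4) {n n' p q : E}
    (h : LinearIndependent ℝ ![p, q]) (hnp : ⟪n, p⟫ = 0) (hn'q : ⟪n', q⟫ = 0)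
    (hp : ‖p‖ = parallelogramArea p q) (hq : ‖q‖ = parallelogramArea p q) :
    Integrable (linkKernel n n' p q) ∧
      ∫ v, linkKernel n n' p q v =
        8 * π * (parallelogramArea p q ^ 2 * ⟪n, n'⟫ + ⟪p, q⟫ * ⟪n, q⟫ * ⟪n', p⟫) /
          parallelogramArea p q ^ 7 := by
  have hpq := parallelogramArea_pos h
  have finrank_orthogonal : finrank ℝ (Submodule.span ℝ (Set.range ![p, q]))ᗮ = 2 := by
    have := (Submodule.span ℝ (Set.range ![p, q])).finrank_add_finrank_orthogonal
    rw [finrank_span_eq_card h, Fintype.card_fin] at this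
    omega
  have : Nontrivial (Submodule.span ℝ (Set.range ![p, q]))ᗮ :=
    nontrivial_of_finrank_pos (R := ℝ) (by omega)
  have coordinates := isChangeOfVariables_slopePoint_span h
  have measurable_kernel : AEStronglyMeasurable (linkKernel n n' p q) :=
    (measurable_linkKernel n n' p q).aestronglyMeasurable
  rw [← coordinates.integrable_comp_iff measurable_kernel,
    ← coordinates.integral_comp measurable_kernel, hE]
  simp only [jacobian_mul_linkKernel_eq_separatedKernel hnp hn'q hp hq hpq]
  refine ⟨(integrable_separatedKernel _ _).const_mul _, ?_⟩
  rw [integral_const_mul, integral_separatedKernel, finrank_orthogonal, Matrix.cons_val_zero,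
    Matrix.cons_val_one, Matrix.cons_val_fin_one,
    Submodule.inner_orthogonalProjectionOnto_eq_of_mem_right,
    real_inner_comm, ← parallelogramArea_sq_mul_inner_starProjection h hnp hn'q,
    Submodule.starProjection_apply, Nat.cast_ofNat, div_self two_ne_zero, rpow_one]
  field_simp
  ring

theorem integrable_and_integral_linkKernel (hE : finrank ℝ E = 4) {n n' c d : E}
    (h : LinearIndependent ℝ ![c, d]) (hnc : ⟪n, c⟫ = 0) (hn'd : ⟪n', d⟫ = 0) :
    Integrable (linkKernel n n' c d) ∧
      ∫ v, linkKernel n n' c d v =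
        8 * π * (parallelogramArea c d ^ 2 * ⟪n, n'⟫ + ⟪c, d⟫ * ⟪n, d⟫ * ⟪n', c⟫) /
          (‖c‖ ^ 2 * ‖d‖ ^ 2 * parallelogramArea c d ^ 3) := by
  have area_pos := parallelogramArea_pos h
  have hc : 0 < ‖c‖ := norm_pos_iff.2 (h.ne_zero 0)
  have hd : 0 < ‖d‖ := norm_pos_iff.2 (h.ne_zero 1)
  set a := ‖d‖ / parallelogramArea c d with ha
  set b := ‖c‖ / parallelogramArea c d with hb
  have a_pos : 0 < a := by positivity
  have b_pos : 0 < b := by positivity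
  have area_eq : parallelogramArea (a • c) (b • d) = ‖c‖ * ‖d‖ / parallelogramArea c d := by
    rw [parallelogramArea_smul_left, parallelogramArea_smul_right, abs_of_pos a_pos,
      abs_of_pos b_pos, ha, hb]
    field_simp
  have rescale (v : E) : linkKernel n n' c d v =
      (a * b) ^ 3 * linkKernel n n' (a • c) (b • d) v := by
    rw [linkKernel_smul_smul, abs_of_pos (by positivity), mul_inv_cancel_left₀ (by positivity)]
  obtain ⟨integrable, integral_eq⟩ := integrable_and_integral_linkKernel_of_norm_eq hE
    (n := n) (n' := n') (p := a • c) (q := b • d)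
    ((LinearIndependent.pair_smul_smul_iff a_pos.ne'.isUnit b_pos.ne'.isUnit).2 h)
    (by rw [real_inner_smul_right, hnc, mul_zero]) (by rw [real_inner_smul_right, hn'd, mul_zero])
    (by rw [norm_smul, Real.norm_of_nonneg a_pos.le, area_eq, ha]; ring)
    (by rw [norm_smul, Real.norm_of_nonneg b_pos.le, area_eq, hb]; ring)
  rw [funext rescale]
  refine ⟨integrable.const_mul _, ?_⟩
  rw [integral_const_mul, integral_eq, area_eq]
  simp only [real_inner_smul_left, real_inner_smul_right, ha, hb]
  field_simp

end LinkKernel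

theorem mainTheorem2 (A A' : Matrix (Fin 4) (Fin 3) ℝ)
    (hindep : LinearIndependent ℝ ![colVec A 2, colVec A' 2]) :
    MeasureTheory.Integrable (linkIntegrand A A') ∧
    Real.pi / 2 * ILinkSq A A' =
      ((‖colVec A 2‖ ^ 2 * ‖colVec A' 2‖ ^ 2 - (inner ℝ (colVec A 2) (colVec A' 2)) ^ 2) *
            (Aᵀ * A').det +
          inner ℝ (colVec A 2) (colVec A' 2) *
            (prependCol (colVec A 2) A').det * (prependCol (colVec A' 2) A).det) /
        (‖colVec A 2‖ ^ 2 * ‖colVec A' 2‖ ^ 2 *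
          (‖colVec A 2‖ ^ 2 * ‖colVec A' 2‖ ^ 2 -
            (inner ℝ (colVec A 2) (colVec A' 2)) ^ 2) ^ (3 / 2 : ℝ)) := by
  obtain ⟨integrable, integral_eq⟩ := integrable_and_integral_linkKernel
    finrank_euclideanSpace_fin hindep (inner_crossVec_colVec A 2) (inner_crossVec_colVec A' 2)
  have area_pos := parallelogramArea_pos hindep
  have area_rpow : (parallelogramArea (colVec A 2) (colVec A' 2) ^ 2) ^ (3 / 2 : ℝ) =
      parallelogramArea (colVec A 2) (colVec A' 2) ^ 3 := by
    rw [← Real.rpow_natCast_mul area_pos.le, ← Real.rpow_natCast]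
    norm_num
  rw [ILinkSq, linkIntegrand_eq_linkKernel, integral_eq, det_prependCol, det_prependCol,
    ← inner_crossVec_crossVec, ← parallelogramArea_sq, area_rpow]
  refine ⟨integrable, ?_⟩
  field_simp
  ring
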